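/- There are absolute constants $C, c > 0$ such that the following holds. Let $L \ge 2$, let $d_0, d_1, \dots, d_L$ be widths with $d_i \ge \min(d_0, d_L)$ for all $1 \le i \le L$, let $n \ge C (d_0 + d_L)$, and let $M^* \in \mathbb{R}^{d_L \times d_0}$. Let $A_1, \dots, A_n$ be independent random $d_L \times d_0$ matrices, each with independent standard Gaussian entries. For parameters $\mathbf{W} = (W_1, \dots, W_L)$ with $W_i \in \mathbb{R}^{d_i \times d_{i-1}}$ put $E(\mathbf{W}) = W_L W_{L-1} \cdots W_1$; for $M \in \mathbb{R}^{d_L \times d_0}$ put $$\mathcal{L}'(M) = \frac1n \sum_{i=1}^n \big(\langle A_i, M\rangle - \langle A_i, M^*\rangle\big)^2, \qquad \mathcal{L}(\mathbf{W}) = \mathcal{L}'(E(\mathbf{W})),$$ where $\langle\cdot,\cdot\rangle$ is the Frobenius inner product. Then, with probability at least $1 - \exp(-c n)$ over $A_1, \dots, A_n$, the minimum $\min_{M : \mathcal{L}'(M) = 0} \|M\|_*$ of the nuclear norm is attained, and every $$\mathbf{W}^* \in \operatorname*{arg\,min}_{\mathbf{W} : \mathcal{L}(\mathbf{W}) = 0}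 \operatorname{tr}[\nabla^2 \mathcal{L}(\mathbf{W})]$$ satisfies $$\|E(\mathbf{W}^*)\|_* \le 3 \min_{M : \mathcal{L}'(M) = 0} \|M\|_* \le 3\, \|E(\mathbf{W}^*)\|_*.$$ -/

import Mathlib

open MeasureTheory ProbabilityTheory

noncomputable section

namespace DeepMatrixFactorization

/-- Parameters of a linear network of depth `k` with widths `d 0, d 1, …, d k`.
The layer matrix `W_{i+1}`, of size `d (i+1) × d i`, is stored at the index `i = 0, …, k-1`. -/
abbrev Params (d : ℕ → ℕ) (k : ℕ) : Type :=
  (i : Fin k) → Matrix (Fin (d (i + 1))) (Fin (d i)) ℝ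

/-- The layer matrix stored at the index `i`. -/
def layer {d : ℕ → ℕ} {k : ℕ} (W : Params d k) (i : ℕ) (h : i < k) :
    Matrix (Fin (d (i + 1))) (Fin (d i)) ℝ :=
  W ⟨i, h⟩

/-- The end-to-end matrix `W_k W_{k-1} ⋯ W_1` (the identity if `k = 0`). -/
def endToEnd (d : ℕ → ℕ) : (k : ℕ) → Params d k → Matrix (Fin (d k)) (Fin (d 0)) ℝ
  | 0, _ => 1
  | k + 1, W => layer W k k.lt_succ_self * endToEnd d k (fun i => W i.castSucc)

/-- The Frobenius inner product of two real matrices. -/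
def frobInner {p q : ℕ} (A M : Matrix (Fin p) (Fin q) ℝ) : ℝ :=
  ∑ a, ∑ b, A a b * M a b

/-- The mean squared error of an end-to-end matrix `M` on the measurements `A i` with the
labels `⟨A i, Mstar⟩`. -/
def matrixLoss {n p q : ℕ} (A : Fin n → Matrix (Fin p) (Fin q) ℝ)
    (Mstar M : Matrix (Fin p) (Fin q) ℝ) : ℝ :=
  (1 / (n : ℝ)) * ∑ i, (frobInner (A i) M - frobInner (A i) Mstar) ^ 2

/-- The training loss of the parameters of the network. -/
def trainingLoss {n : ℕ} (d : ℕ → ℕ) (L : ℕ) (A : Fin n → Matrix (Fin (d L)) (Fin (d 0)) ℝ)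
    (Mstar : Matrix (Fin (d L)) (Fin (d 0)) ℝ) (W : Params d L) : ℝ :=
  matrixLoss A Mstar (endToEnd d L W)

/-- Indices of the scalar parameters: a layer and an entry of its matrix. -/
abbrev ParamIndex (d : ℕ → ℕ) (k : ℕ) : Type :=
  (i : Fin k) × (Fin (d (i + 1)) × Fin (d i))

/-- The coordinate direction of a scalar parameter. -/
def coordDir {d : ℕ → ℕ} {k : ℕ} (p : ParamIndex d k) : Params d k :=
  Pi.single p.1 (Matrix.single p.2.1 p.2.2 1)

/-- The Hessian of a function of the parameters: the matrix of its second partial derivatives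
with respect to the scalar parameters. -/
def hessian {d : ℕ → ℕ} {k : ℕ} (f : Params d k → ℝ) (W : Params d k) :
    Matrix (ParamIndex d k) (ParamIndex d k) ℝ :=
  Matrix.of fun p q => lineDeriv ℝ (fun V => lineDeriv ℝ f V (coordDir q)) W (coordDir p)

/-- `W` minimizes the trace of the Hessian of the training loss over all parameters
with zero training loss. -/
def IsMinTraceHessianInterpolator {n : ℕ} (d : ℕ → ℕ) (L : ℕ)
    (A : Fin n → Matrix (Fin (d L)) (Fin (d 0)) ℝ)
    (Mstar : Matrix (Fin (d L)) (Fin (d 0)) ℝ) (W : Params d L) : Prop :=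
  trainingLoss d L A Mstar W = 0 ∧
    IsMinOn (fun V => (hessian (trainingLoss d L A Mstar) V).trace)
      {V | trainingLoss d L A Mstar V = 0} W

/-- The nuclear norm (Schatten 1-norm): the sum of the singular values. -/
def nuclearNorm {p q : ℕ} (M : Matrix (Fin p) (Fin q) ℝ) : ℝ :=
  ∑ i ∈ Finset.range (min p q), (Matrix.toEuclideanLin M).singularValues i

/-- The product (Borel) σ-algebra on matrices. -/
instance instMeasurableSpaceMatrix {p q : ℕ} : MeasurableSpace (Matrix (Fin p) (Fin q) ℝ) :=
  inferInstanceAs (MeasurableSpace (Fin p → Fin q → ℝ))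

/-- The law of a random `p × q` matrix with independent standard Gaussian entries. -/
def gaussianMatrix (p q : ℕ) : Measure (Matrix (Fin p) (Fin q) ℝ) :=
  (Measure.pi fun _ : Fin p => Measure.pi fun _ : Fin q => gaussianReal 0 1 :
    Measure (Fin p → Fin q → ℝ))

end DeepMatrixFactorization

end

open DeepMatrixFactorization

/-! The loss is quadratic along each coordinate line, because the end-to-end product is affine in
each scalar parameter, with a rank-one slope. The Hessian trace is therefore a sum of empirical
second moments of rank-one matrices. If the measurements satisfy `RankOneRIP`, this trace lies
between `flatness` and three times `flatness`, where `flatness` is a sum over layers of (suffix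
norm)² (prefix norm)² and does not depend on the data.

Write N for the nuclear norm of the end-to-end matrix. AM-GM over the L terms, together with ‖XY‖_*²
≤ ‖X‖²‖Y‖² in Frobenius norms, gives flatness^L ≥ L^L d_0 d_L N^(2(L-1))
(`nuclearNorm_pow_le_flatness_pow`). Every matrix has a network with equality
(`exists_layers_flatness_pow_eq`); this is where the width condition enters. Comparing a trace
minimizer with the optimal network of a minimal-norm interpolator loses a factor 3^(L/(2(L-1))),
which is at most 3 since L ≥ 2.

The isometry property holds with high probability by chi-square tails on a net of pairs of vectors,
extended to all pairs by bilinearity (`exists_measurableSet_rankOneRIP`). -/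

namespace DeepMatrixFactorization

/-- The squared Frobenius norm. -/
def frobSq {p q : ℕ} (M : Matrix (Fin p) (Fin q) ℝ) : ℝ := ∑ a, ∑ b, M a b ^ 2

lemma frobSq_nonneg {p q : ℕ} (M : Matrix (Fin p) (Fin q) ℝ) : 0 ≤ frobSq M :=
  Finset.sum_nonneg fun _ _ => Finset.sum_nonneg fun _ _ => sq_nonneg _

lemma frobSq_transpose {p q : ℕ} (M : Matrix (Fin p) (Fin q) ℝ) : frobSq M.transpose = frobSq M :=
  Finset.sum_comm

/-! ### Singular vectors, the nuclear norm and its factorizations -/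

section SingularVectors

open Module

variable {p q : ℕ} (M : Matrix (Fin p) (Fin q) ℝ)

/-- An eigenbasis of T*T serves, its eigenvalues being the squared singular values of T. -/
lemma exists_rightSingularBasis :
    ∃ v : OrthonormalBasis (Fin q) ℝ (EuclideanSpace ℝ (Fin q)), ∀ k l,
      inner ℝ (M.toEuclideanLin (v k)) (M.toEuclideanLin (v l)) =
        if k = l then M.toEuclideanLin.singularValues k ^ 2 else 0 := by
  set T := M.toEuclideanLin
  have hn : finrank ℝ (EuclideanSpace ℝ (Fin q)) = q := by simp
  refine ⟨T.isSymmetric_adjoint_comp_self.eigenvectorBasis hn, fun k l => ?_⟩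
  have h := T.isSymmetric_adjoint_comp_self.apply_eigenvectorBasis hn l
  rw [← LinearMap.adjoint_inner_right]
  rw [LinearMap.comp_apply] at h
  rw [h, inner_smul_right, OrthonormalBasis.inner_eq_ite]
  split_ifs with hkl
  · subst hkl
    rw [T.sq_singularValues_fin hn]
    simp
  · simp

lemma singularValues_eq_zero_of_height_le {k : ℕ} (hk : p ≤ k) :
    M.toEuclideanLin.singularValues k = 0 := by
  rw [LinearMap.singularValues_eq_zero_iff_le_finrank_range]
  refine le_trans (Submodule.finrank_le _) ?_
  simpa using hk

lemma sum_fin_min_eq_sum_fin {f : ℕ → ℝ} (hf : ∀ k, p ≤ k → f k = 0) :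
    ∑ k ∈ Finset.range (min p q), f k = ∑ k : Fin q, f k := by
  rw [← Finset.sum_range]
  refine Finset.sum_subset (by simp) fun k hk hk' => hf k ?_
  simp only [Finset.mem_range] at hk hk'
  omega

lemma nuclearNorm_eq_sum_fin :
    nuclearNorm M = ∑ k : Fin q, M.toEuclideanLin.singularValues k :=
  sum_fin_min_eq_sum_fin fun _ => singularValues_eq_zero_of_height_le M

lemma nuclearNorm_nonneg : 0 ≤ nuclearNorm M :=
  Finset.sum_nonneg fun k _ => LinearMap.singularValues_nonneg _ k

lemma toEuclideanLin_apply_eq_inner (x : EuclideanSpace ℝ (Fin q)) (a : Fin p) :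
    M.toEuclideanLin x a = inner ℝ (WithLp.toLp 2 (M a)) x := by
  simp [Matrix.toLpLin_apply, Matrix.mulVec, dotProduct, PiLp.inner_apply, mul_comm]

lemma sum_norm_sq_toEuclideanLin (v : OrthonormalBasis (Fin q) ℝ (EuclideanSpace ℝ (Fin q))) :
    ∑ k, ‖M.toEuclideanLin (v k)‖ ^ 2 = frobSq M := by
  simp_rw [EuclideanSpace.norm_sq_eq, toEuclideanLin_apply_eq_inner]
  rw [Finset.sum_comm]
  refine Finset.sum_congr rfl fun a _ => ?_
  rw [OrthonormalBasis.sum_sq_norm_inner_left, EuclideanSpace.norm_sq_eq]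
  simp

/-- The singular values are the pairings of `M v k` with a family of orthonormal (or zero) left
singular vectors, expressed through Bessel's inequality. -/
lemma exists_singularVectors :
    ∃ (v : OrthonormalBasis (Fin q) ℝ (EuclideanSpace ℝ (Fin q)))
      (u : Fin q → EuclideanSpace ℝ (Fin p)),
      (∀ k, inner ℝ (u k) (M.toEuclideanLin (v k)) = M.toEuclideanLin.singularValues k) ∧
      ∀ x : EuclideanSpace ℝ (Fin p), ∑ k, inner ℝ (u k) x ^ 2 ≤ ‖x‖ ^ 2 := by
  obtain ⟨v, hv⟩ := exists_rightSingularBasis M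
  set s : Fin q → ℝ := fun k => M.toEuclideanLin.singularValues k with hs
  have hv' : ∀ k l, inner ℝ (M.toEuclideanLin (v k)) (M.toEuclideanLin (v l)) =
      if k = l then s k ^ 2 else 0 := hv
  -- Since 0⁻¹ = 0, the left vector is zero where the singular value is; the others are orthonormal,
  -- which suffices for Bessel.
  refine ⟨v, fun k => (s k)⁻¹ • M.toEuclideanLin (v k), fun k => ?_, fun x => ?_⟩
  · rw [real_inner_smul_left, hv', if_pos rfl]
    change _ = s k
    by_cases h : s k = 0
    · simp [h]
    · field_simp
  · have ho : Orthonormal ℝ (fun k : {k : Fin q // s k ≠ 0} =>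
        (s k)⁻¹ • M.toEuclideanLin (v k)) := by
      rw [orthonormal_iff_ite]
      rintro ⟨k, hk⟩ ⟨l, hl⟩
      rw [real_inner_smul_left, real_inner_smul_right, hv']
      by_cases h : k = l
      · subst h
        simp only [if_true]
        field_simp
      · simp [h]
    have hb := ho.sum_inner_products_le x (s := Finset.univ)
    refine le_trans (le_of_eq ?_) hb
    simp only [Real.norm_eq_abs, sq_abs]
    rw [← Finset.sum_subtype (Finset.univ.filter fun k => s k ≠ 0) (by simp)
      (fun k => inner ℝ ((s k)⁻¹ • M.toEuclideanLin (v k)) x ^ 2), Finset.sum_filter_of_ne]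
    intro k _ hk h0
    simp [h0] at hk

end SingularVectors

/-- Each singular value is ⟨Xᵀu_k, Yv_k⟩; apply Cauchy–Schwarz to each pairing and then to the sum.
Bessel bounds ∑‖Xᵀu_k‖². -/
lemma nuclearNorm_mul_sq_le {p r q : ℕ} (X : Matrix (Fin p) (Fin r) ℝ)
    (Y : Matrix (Fin r) (Fin q) ℝ) : nuclearNorm (X * Y) ^ 2 ≤ frobSq X * frobSq Y := by
  obtain ⟨v, u, huv, hu⟩ := exists_singularVectors (X * Y)
  have hpair : ∀ k : Fin q, ((X * Y).toEuclideanLin.singularValues k : ℝ) =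
      inner ℝ (X.transpose.toEuclideanLin (u k)) (Y.toEuclideanLin (v k)) := by
    intro k
    rw [← huv k, ← Matrix.conjTranspose_eq_transpose_of_trivial,
      Matrix.toEuclideanLin_conjTranspose_eq_adjoint, LinearMap.adjoint_inner_left]
    congr 1
    simp [Matrix.toLpLin_apply]
  have hX : ∑ k, ‖X.transpose.toEuclideanLin (u k)‖ ^ 2 ≤ frobSq X := by
    simp_rw [EuclideanSpace.norm_sq_eq, toEuclideanLin_apply_eq_inner]
    rw [Finset.sum_comm, ← frobSq_transpose]
    refine Finset.sum_le_sum fun c _ => ?_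
    have := hu (WithLp.toLp 2 (X.transpose c))
    rw [EuclideanSpace.norm_sq_eq] at this
    simpa [real_inner_comm] using this
  rw [nuclearNorm_eq_sum_fin]
  calc (∑ k : Fin q, (X * Y).toEuclideanLin.singularValues k) ^ 2
      ≤ (∑ k : Fin q, ‖X.transpose.toEuclideanLin (u k)‖ * ‖Y.toEuclideanLin (v k)‖) ^ 2 := by
        refine pow_le_pow_left₀ (Finset.sum_nonneg fun k _ => LinearMap.singularValues_nonneg _ _)
          (Finset.sum_le_sum fun k _ => ?_) 2
        rw [hpair]
        exact real_inner_le_norm _ _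
    _ ≤ (∑ k, ‖X.transpose.toEuclideanLin (u k)‖ ^ 2) * ∑ k, ‖Y.toEuclideanLin (v k)‖ ^ 2 :=
        Finset.sum_mul_sq_le_sq_mul_sq _ _ _
    _ ≤ frobSq X * frobSq Y := by
        rw [sum_norm_sq_toEuclideanLin]
        exact mul_le_mul_of_nonneg_right hX (frobSq_nonneg _)

/-- Split the singular value decomposition, giving √s_k to each side. This is the equality case of
`nuclearNorm_mul_sq_le`. -/
lemma exists_balanced_factorization {p q : ℕ} (M : Matrix (Fin p) (Fin q) ℝ) :
    ∃ (X : Matrix (Fin p) (Fin (min p q)) ℝ) (Y : Matrix (Fin (min p q)) (Fin q) ℝ),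
      X * Y = M ∧ frobSq X = nuclearNorm M ∧ frobSq Y = nuclearNorm M := by
  obtain ⟨v, hv⟩ := exists_rightSingularBasis M
  set s : ℕ → ℝ := fun k => M.toEuclideanLin.singularValues k with hs
  have hs0 : ∀ k, 0 ≤ s k := fun k => LinearMap.singularValues_nonneg _ k
  have hsp : ∀ k, p ≤ k → s k = 0 := fun k hk => singularValues_eq_zero_of_height_le M hk
  have hTv : ∀ k : Fin q, ‖M.toEuclideanLin (v k)‖ ^ 2 = s k ^ 2 := by
    intro k
    rw [← real_inner_self_eq_norm_sq, hv, if_pos rfl]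
  set w : ℕ → EuclideanSpace ℝ (Fin q) := fun k => if h : k < q then v ⟨k, h⟩ else 0 with hw
  have hwv : ∀ k : Fin q, w k = v k := fun k => by simp [hw]
  refine ⟨Matrix.of fun a k => (√(s k))⁻¹ * M.toEuclideanLin (w k) a,
    Matrix.of fun k b => √(s k) * w k b, ?_, ?_, ?_⟩
  · ext a b
    rw [Matrix.mul_apply]
    simp only [Matrix.of_apply]
    rw [← Finset.sum_range (n := min p q)
      (fun k => (√(s k))⁻¹ * M.toEuclideanLin (w k) a * (√(s k) * w k b)),
      sum_fin_min_eq_sum_fin (fun k hk => by simp [hsp k hk])]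
    have h1 : ∀ k : Fin q, (√(s k))⁻¹ * M.toEuclideanLin (w k) a * (√(s k) * w k b) =
        v k b * M.toEuclideanLin (v k) a := by
      intro k
      rw [hwv]
      by_cases h : s k = 0
      · have : M.toEuclideanLin (v k) = 0 := by
          have := hTv k
          rw [h] at this
          simpa using this
        simp [this, h]
      · have : √(s k) ≠ 0 := by
          rw [Real.sqrt_ne_zero (hs0 k)]; exact h
        field_simp
    rw [Finset.sum_congr rfl fun k _ => h1 k]
    have h2 := v.sum_repr (EuclideanSpace.single b (1 : ℝ))
    have h3 := congrArg (fun x => M.toEuclideanLin x a) h2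
    simp only [map_sum, map_smul, v.repr_apply_apply] at h3
    simpa [EuclideanSpace.inner_single_right, Matrix.toLpLin_apply, Matrix.mulVec_single] using h3
  · have h1 : ∀ k : Fin q, ∑ a, ((√(s k))⁻¹ * M.toEuclideanLin (w k) a) ^ 2 = s k := by
      intro k
      rw [hwv]
      simp_rw [mul_pow]
      rw [← Finset.mul_sum]
      have := hTv k
      rw [EuclideanSpace.norm_sq_eq] at this
      simp only [Real.norm_eq_abs, sq_abs] at this
      rw [this, inv_pow, Real.sq_sqrt (hs0 k)]
      by_cases h : s k = 0
      · simp [h]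
      · field_simp
    rw [← frobSq_transpose, frobSq]
    simp only [Matrix.transpose_apply, Matrix.of_apply]
    rw [← Finset.sum_range (n := min p q)
      (fun k => ∑ a, ((√(s k))⁻¹ * M.toEuclideanLin (w k) a) ^ 2),
      sum_fin_min_eq_sum_fin (fun k hk => by simp [hsp k hk]), nuclearNorm_eq_sum_fin]
    exact Finset.sum_congr rfl fun k _ => h1 k
  · have h1 : ∀ k : Fin q, ∑ b, (√(s k) * w k b) ^ 2 = s k := by
      intro k
      rw [hwv]
      simp_rw [mul_pow]
      rw [← Finset.mul_sum, Real.sq_sqrt (hs0 k)]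
      have := EuclideanSpace.norm_sq_eq (v k)
      simp only [Real.norm_eq_abs, sq_abs, v.norm_eq_one] at this
      rw [← this]; simp
    rw [frobSq]
    simp only [Matrix.of_apply]
    rw [← Finset.sum_range (n := min p q) (fun k => ∑ b, (√(s k) * w k b) ^ 2),
      sum_fin_min_eq_sum_fin (fun k hk => by simp [hsp k hk]), nuclearNorm_eq_sum_fin]
    exact Finset.sum_congr rfl fun k _ => h1 k

/-! ### Attainment of the minimal nuclear norm -/

lemma continuous_frobSq {p q : ℕ} : Continuous (frobSq : Matrix (Fin p) (Fin q) ℝ → ℝ) := by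
  unfold frobSq
  fun_prop

lemma sq_apply_le_frobSq {p q : ℕ} (M : Matrix (Fin p) (Fin q) ℝ) (a : Fin p) (b : Fin q) :
    M a b ^ 2 ≤ frobSq M :=
  (Finset.single_le_sum (f := fun b => M a b ^ 2) (fun _ _ => sq_nonneg _)
    (Finset.mem_univ b)).trans
    (Finset.single_le_sum (f := fun a => ∑ b, M a b ^ 2)
      (fun _ _ => Finset.sum_nonneg fun _ _ => sq_nonneg _) (Finset.mem_univ a))

lemma isCompact_frobSq_le (p q : ℕ) (c : ℝ) :
    IsCompact {M : Matrix (Fin p) (Fin q) ℝ | frobSq M ≤ c} := by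
  have hbox : IsCompact (Set.univ.pi fun _ : Fin p => Set.univ.pi fun _ : Fin q =>
      Set.Icc (-(c + 1)) (c + 1)) :=
    isCompact_univ_pi fun _ => isCompact_univ_pi fun _ => isCompact_Icc
  refine IsCompact.of_isClosed_subset hbox (isClosed_le continuous_frobSq continuous_const) ?_
  intro M hM a _ b _
  have h := (sq_apply_le_frobSq M a b).trans hM
  constructor <;> nlinarith [sq_nonneg (M a b - 1), sq_nonneg (M a b + 1)]

lemma exists_min_frobSq_add_frobSq {p r q : ℕ} {S : Set (Matrix (Fin p) (Fin q) ℝ)}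
    (hS : IsClosed S) (c : ℝ)
    (hne : ∃ (X : Matrix (Fin p) (Fin r) ℝ) (Y : Matrix (Fin r) (Fin q) ℝ),
      X * Y ∈ S ∧ frobSq X ≤ c ∧ frobSq Y ≤ c) :
    ∃ (X₀ : Matrix (Fin p) (Fin r) ℝ) (Y₀ : Matrix (Fin r) (Fin q) ℝ), X₀ * Y₀ ∈ S ∧
      ∀ (X : Matrix (Fin p) (Fin r) ℝ) (Y : Matrix (Fin r) (Fin q) ℝ), X * Y ∈ S →
        frobSq X ≤ c → frobSq Y ≤ c → frobSq X₀ + frobSq Y₀ ≤ frobSq X + frobSq Y := by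
  have hK : IsCompact (({X : Matrix (Fin p) (Fin r) ℝ | frobSq X ≤ c} ×ˢ
      {Y : Matrix (Fin r) (Fin q) ℝ | frobSq Y ≤ c}) ∩ {Z | Z.1 * Z.2 ∈ S}) :=
    ((isCompact_frobSq_le _ _ _).prod (isCompact_frobSq_le _ _ _)).inter_right
      (hS.preimage (continuous_fst.matrix_mul continuous_snd))
  have hf : Continuous fun Z : Matrix (Fin p) (Fin r) ℝ × Matrix (Fin r) (Fin q) ℝ =>
      frobSq Z.1 + frobSq Z.2 :=
    (continuous_frobSq.comp continuous_fst).add (continuous_frobSq.comp continuous_snd)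
  obtain ⟨X₁, Y₁, h1, h2, h3⟩ := hne
  obtain ⟨Z₀, hZ₀, hmin⟩ := hK.exists_isMinOn ⟨(X₁, Y₁), ⟨h2, h3⟩, h1⟩ hf.continuousOn
  exact ⟨Z₀.1, Z₀.2, hZ₀.2, fun X Y h1 h2 h3 => isMinOn_iff.mp hmin (X, Y) ⟨⟨h2, h3⟩, h1⟩⟩

/-- The nuclear norm attains its minimum on a nonempty closed set of matrices: minimize
`(‖X‖² + ‖Y‖²) / 2` over the factorizations `X * Y` of its elements. -/
lemma exists_isLeast_nuclearNorm_image {p q : ℕ} {S : Set (Matrix (Fin p) (Fin q) ℝ)}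
    (hS : IsClosed S) (hne : S.Nonempty) : ∃ m, IsLeast (nuclearNorm '' S) m := by
  obtain ⟨M₁, hM₁⟩ := hne
  obtain ⟨X₁, Y₁, hXY₁, hX₁, hY₁⟩ := exists_balanced_factorization M₁
  obtain ⟨X₀, Y₀, h₀, hmin⟩ := exists_min_frobSq_add_frobSq hS (nuclearNorm M₁)
    ⟨X₁, Y₁, hXY₁ ▸ hM₁, hX₁.le, hY₁.le⟩
  refine ⟨nuclearNorm (X₀ * Y₀), ⟨X₀ * Y₀, h₀, rfl⟩, ?_⟩
  rintro _ ⟨M, hM, rfl⟩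
  have h1 : nuclearNorm (X₀ * Y₀) ≤ (frobSq X₀ + frobSq Y₀) / 2 := by
    refine le_of_sq_le_sq ?_ (by linarith [frobSq_nonneg X₀, frobSq_nonneg Y₀])
    refine (nuclearNorm_mul_sq_le X₀ Y₀).trans ?_
    nlinarith [sq_nonneg (frobSq X₀ - frobSq Y₀)]
  rcases le_total (nuclearNorm M) (nuclearNorm M₁) with hle | hle
  · obtain ⟨X, Y, hXY, hX, hY⟩ := exists_balanced_factorization M
    have := hmin X Y (hXY ▸ hM) (hX.le.trans hle) (hY.le.trans hle)
    linarith
  · have := hmin X₁ Y₁ (hXY₁ ▸ hM₁) hX₁.le hY₁.le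
    linarith

/-! ### Layer products and the trace of the Hessian -/

/-- An infinite sequence of layer matrices with widths `d`. -/
abbrev Layers (d : ℕ → ℕ) : Type := (i : ℕ) → Matrix (Fin (d (i + 1))) (Fin (d i)) ℝ

/-- The `p × q` matrix with ones on the main diagonal. -/
def partialId (p q : ℕ) : Matrix (Fin p) (Fin q) ℝ :=
  Matrix.of fun a b => if (a : ℕ) = b then 1 else 0

lemma partialId_self (p : ℕ) : partialId p p = 1 := by
  ext a b
  simp [partialId, Matrix.one_apply, Fin.ext_iff]

/-- The product `V (k - 1) * ⋯ * V j`; only meaningful for `j ≤ k`. -/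
def layerProd {d : ℕ → ℕ} (V : Layers d) (j : ℕ) : (k : ℕ) → Matrix (Fin (d k)) (Fin (d j)) ℝ
  | 0 => partialId _ _
  | k + 1 => if j = k + 1 then partialId _ _ else V k * layerProd V j k

section LayerProd

variable {d : ℕ → ℕ} (V : Layers d)

lemma layerProd_self (j : ℕ) : layerProd V j j = 1 := by
  cases j <;> simp [layerProd, partialId_self]

lemma layerProd_succ {j k : ℕ} (h : j ≤ k) : layerProd V j (k + 1) = V k * layerProd V j k := by
  rw [layerProd, if_neg (by omega)]

lemma layerProd_mul_layerProd {i j k : ℕ} (hij : i ≤ j) (hjk : j ≤ k) :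
    layerProd V j k * layerProd V i j = layerProd V i k := by
  induction k, hjk using Nat.le_induction with
  | base => rw [layerProd_self, Matrix.one_mul]
  | succ k hk ih => rw [layerProd_succ V hk, layerProd_succ V (hij.trans hk), Matrix.mul_assoc, ih]

lemma layerProd_congr {V V' : Layers d} {j k : ℕ} (hjk : j ≤ k)
    (h : ∀ i, j ≤ i → i < k → V i = V' i) : layerProd V j k = layerProd V' j k := by
  induction k, hjk using Nat.le_induction with
  | base => rw [layerProd_self, layerProd_self]
  | succ k hk ih =>
    rw [layerProd_succ V hk, layerProd_succ V' hk, ih fun i h1 h2 => h i h1 (by omega),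
      h k hk (by omega)]

lemma layerProd_add_single {j k : ℕ} (hjk : j < k)
    (E : Matrix (Fin (d (j + 1))) (Fin (d j)) ℝ) :
    layerProd (V + Pi.single j E) 0 k =
      layerProd V 0 k + layerProd V (j + 1) k * E * layerProd V 0 j := by
  induction k, hjk using Nat.le_induction with
  | base =>
    have h : layerProd (V + Pi.single j E) 0 j = layerProd V 0 j :=
      layerProd_congr j.zero_le fun i _ hi => by simp [Pi.single_eq_of_ne hi.ne]
    rw [layerProd_succ _ j.zero_le, layerProd_succ _ j.zero_le, layerProd_self, h, Matrix.one_mul,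
      Pi.add_apply, Pi.single_eq_same, Matrix.add_mul]
  | succ k hk ih =>
    have h : (V + Pi.single j E : Layers d) k = V k := by
      simp [Pi.single_eq_of_ne (show k ≠ j by omega)]
    rw [layerProd_succ _ k.zero_le, layerProd_succ V k.zero_le, layerProd_succ V hk, ih, h,
      Matrix.mul_add]
    simp only [Matrix.mul_assoc]

lemma endToEnd_eq_layerProd (k : ℕ) :
    endToEnd d k (fun i => V i) = layerProd V 0 k := by
  induction k with
  | zero => rw [layerProd_self]; rfl
  | succ k ih =>
    rw [layerProd_succ V k.zero_le, ← ih]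
    rfl

end LayerProd

/-- The layers of a network, continued by zero. -/
def extendLayers {d : ℕ → ℕ} {k : ℕ} (W : Params d k) : Layers d :=
  fun i => if h : i < k then W ⟨i, h⟩ else 0

lemma extendLayers_fin {d : ℕ → ℕ} {k : ℕ} (W : Params d k) :
    (fun i : Fin k => extendLayers W i) = W := by
  funext i
  simp [extendLayers]

lemma endToEnd_eq_extendLayers {d : ℕ → ℕ} {k : ℕ} (W : Params d k) :
    endToEnd d k W = layerProd (extendLayers W) 0 k := by
  rw [← endToEnd_eq_layerProd, extendLayers_fin]

lemma endToEnd_add_smul_coordDir {d : ℕ → ℕ} {k : ℕ} (W : Params d k) (p : ParamIndex d k)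
    (t : ℝ) :
    endToEnd d k (W + t • coordDir p) = endToEnd d k W +
      t • (layerProd (extendLayers W) (p.1 + 1) k * Matrix.single p.2.1 p.2.2 (1 : ℝ) *
        layerProd (extendLayers W) 0 p.1) := by
  have h : W + t • coordDir p = fun i : Fin k =>
      (extendLayers W + Pi.single (p.1 : ℕ) (t • Matrix.single p.2.1 p.2.2 1) : Layers d) i := by
    funext i
    rcases eq_or_ne i p.1 with rfl | hi
    · simp [coordDir, extendLayers]
    · have hi' : (i : ℕ) ≠ p.1 := fun h => hi (Fin.ext h)
      simp [coordDir, extendLayers, Pi.single_eq_of_ne hi, Pi.single_eq_of_ne hi']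
  rw [h, endToEnd_eq_layerProd, layerProd_add_single _ p.1.2, endToEnd_eq_extendLayers,
    Matrix.mul_smul, Matrix.smul_mul]

/-- Only the restriction of f to one line matters, so no differentiability of f is needed. -/
lemma lineDeriv_lineDeriv_of_quadratic {E : Type*} [AddCommGroup E] [Module ℝ E] {f : E → ℝ}
    {x v : E} {a b c : ℝ} (h : ∀ t : ℝ, f (x + t • v) = a + b * t + c * t ^ 2) :
    lineDeriv ℝ (fun y => lineDeriv ℝ f y v) x v = 2 * c := by
  have h1 : ∀ s : ℝ, lineDeriv ℝ f (x + s • v) v = b + 2 * c * s := by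
    intro s
    have : (fun t : ℝ => f (x + s • v + t • v)) =
        fun t => a + b * (s + t) + c * (s + t) ^ 2 := by
      funext t
      rw [add_assoc, ← add_smul, h]
    rw [lineDeriv, this]
    have hd : HasDerivAt (fun t : ℝ => a + b * (s + t) + c * (s + t) ^ 2)
        (0 + b * 1 + c * (((2 : ℕ) : ℝ) * (s + 0) ^ (2 - 1) * 1)) 0 :=
      ((hasDerivAt_const _ _).add (((hasDerivAt_id (0 : ℝ)).const_add s).const_mul b)).add
        ((((hasDerivAt_id (0 : ℝ)).const_add s).pow 2).const_mul c)
    rw [hd.deriv]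
    push_cast
    ring
  rw [lineDeriv]
  simp_rw [h1]
  have hd : HasDerivAt (fun t : ℝ => b + 2 * c * t) (2 * c * 1) 0 :=
    ((hasDerivAt_id (0 : ℝ)).const_mul (2 * c)).const_add b
  rw [hd.deriv, mul_one]

lemma frobInner_add {p q : ℕ} (A M N : Matrix (Fin p) (Fin q) ℝ) :
    frobInner A (M + N) = frobInner A M + frobInner A N := by
  simp [frobInner, mul_add, Finset.sum_add_distrib]

lemma frobInner_smul {p q : ℕ} (A M : Matrix (Fin p) (Fin q) ℝ) (t : ℝ) :
    frobInner A (t • M) = t * frobInner A M := by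
  simp only [frobInner, Matrix.smul_apply, smul_eq_mul, Finset.mul_sum]
  exact Finset.sum_congr rfl fun _ _ => Finset.sum_congr rfl fun _ _ => by ring

/-- The residuals enter only the constant and linear coefficients along a coordinate line, so the
formula holds off the zero-loss set too. -/
lemma trace_hessian_trainingLoss {n : ℕ} (d : ℕ → ℕ) (L : ℕ)
    (A : Fin n → Matrix (Fin (d L)) (Fin (d 0)) ℝ) (Mstar : Matrix (Fin (d L)) (Fin (d 0)) ℝ)
    (W : Params d L) :
    (hessian (trainingLoss d L A Mstar) W).trace =
      ∑ p : ParamIndex d L, 2 * ((1 / (n : ℝ)) * ∑ i, frobInner (A i)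
        (layerProd (extendLayers W) (p.1 + 1) L * Matrix.single p.2.1 p.2.2 (1 : ℝ) *
          layerProd (extendLayers W) 0 p.1) ^ 2) := by
  rw [Matrix.trace]
  refine Finset.sum_congr rfl fun p _ => ?_
  rw [Matrix.diag_apply, hessian, Matrix.of_apply]
  set D := layerProd (extendLayers W) (p.1 + 1) L * Matrix.single p.2.1 p.2.2 (1 : ℝ) *
    layerProd (extendLayers W) 0 p.1 with hD
  refine lineDeriv_lineDeriv_of_quadratic
    (a := (1 / (n : ℝ)) * ∑ i, (frobInner (A i) (endToEnd d L W) - frobInner (A i) Mstar) ^ 2)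
    (b := (1 / (n : ℝ)) * ∑ i, 2 * (frobInner (A i) (endToEnd d L W) - frobInner (A i) Mstar) *
      frobInner (A i) D) fun t => ?_
  rw [trainingLoss, matrixLoss, endToEnd_add_smul_coordDir, ← hD, mul_assoc, mul_assoc, ← mul_add,
    ← mul_add, Finset.sum_mul, Finset.sum_mul, ← Finset.sum_add_distrib, ← Finset.sum_add_distrib]
  congr 1
  refine Finset.sum_congr rfl fun i _ => ?_
  rw [frobInner_add, frobInner_smul]
  ring

lemma frobInner_mul_single_mul {p q r s : ℕ} (A : Matrix (Fin p) (Fin q) ℝ)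
    (S : Matrix (Fin p) (Fin r) ℝ) (T : Matrix (Fin s) (Fin q) ℝ) (a : Fin r) (b : Fin s) :
    frobInner A (S * Matrix.single a b (1 : ℝ) * T) =
      frobInner A (Matrix.vecMulVec (fun c => S c a) (T b)) := by
  congr 1
  ext c e
  rw [Matrix.mul_apply, Finset.sum_eq_single b]
  · simp [Matrix.vecMulVec_apply]
  · intro x _ hx
    rw [Matrix.mul_single_apply_of_ne _ _ _ _ _ hx, zero_mul]
  · simp

/-! ### Comparison of the Hessian trace with the flatness -/

/-- The restricted isometry property for matrices of rank one with constant `1 / 2`. -/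
def RankOneRIP {n p q : ℕ} (A : Fin n → Matrix (Fin p) (Fin q) ℝ) : Prop :=
  ∀ (u : Fin p → ℝ) (v : Fin q → ℝ),
    1 / 2 * ((∑ a, u a ^ 2) * ∑ b, v b ^ 2) ≤
      (1 / (n : ℝ)) * ∑ i, frobInner (A i) (Matrix.vecMulVec u v) ^ 2 ∧
    (1 / (n : ℝ)) * ∑ i, frobInner (A i) (Matrix.vecMulVec u v) ^ 2 ≤
      3 / 2 * ((∑ a, u a ^ 2) * ∑ b, v b ^ 2)

/-- The data-independent flatness measure of a network of depth `L`. -/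
def flatness {d : ℕ → ℕ} (L : ℕ) (V : Layers d) : ℝ :=
  ∑ j ∈ Finset.range L, frobSq (layerProd V (j + 1) L) * frobSq (layerProd V 0 j)

lemma flatness_eq_sum_paramIndex {d : ℕ → ℕ} (L : ℕ) (V : Layers d) :
    flatness L V = ∑ p : ParamIndex d L, (∑ c, layerProd V (p.1 + 1) L c p.2.1 ^ 2) *
      ∑ e, layerProd V 0 p.1 p.2.2 e ^ 2 := by
  rw [flatness, Finset.sum_range, Fintype.sum_sigma]
  refine Finset.sum_congr rfl fun j _ => ?_
  rw [Fintype.sum_prod_type, ← frobSq_transpose, frobSq, frobSq, Finset.sum_mul_sum]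
  rfl

lemma flatness_le_trace_hessian {n : ℕ} {d : ℕ → ℕ} {L : ℕ}
    {A : Fin n → Matrix (Fin (d L)) (Fin (d 0)) ℝ} (hA : RankOneRIP A)
    (Mstar : Matrix (Fin (d L)) (Fin (d 0)) ℝ) (W : Params d L) :
    flatness L (extendLayers W) ≤ (hessian (trainingLoss d L A Mstar) W).trace := by
  rw [trace_hessian_trainingLoss, flatness_eq_sum_paramIndex]
  refine Finset.sum_le_sum fun p _ => ?_
  simp_rw [frobInner_mul_single_mul]
  linarith [(hA (fun c => layerProd (extendLayers W) (p.1 + 1) L c p.2.1)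
    (layerProd (extendLayers W) 0 p.1 p.2.2)).1]

lemma trace_hessian_le_flatness {n : ℕ} {d : ℕ → ℕ} {L : ℕ}
    {A : Fin n → Matrix (Fin (d L)) (Fin (d 0)) ℝ} (hA : RankOneRIP A)
    (Mstar : Matrix (Fin (d L)) (Fin (d 0)) ℝ) (W : Params d L) :
    (hessian (trainingLoss d L A Mstar) W).trace ≤ 3 * flatness L (extendLayers W) := by
  rw [trace_hessian_trainingLoss, flatness_eq_sum_paramIndex, Finset.mul_sum]
  refine Finset.sum_le_sum fun p _ => ?_
  simp_rw [frobInner_mul_single_mul]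
  linarith [(hA (fun c => layerProd (extendLayers W) (p.1 + 1) L c p.2.1)
    (layerProd (extendLayers W) 0 p.1 p.2.2)).2]

/-! ### Minimal flatness for a given end-to-end matrix -/

lemma card_pow_mul_prod_le_sum_pow (n : ℕ) (x : ℕ → ℝ) (hx : ∀ i, 0 ≤ x i) :
    (n : ℝ) ^ n * ∏ i ∈ Finset.range n, x i ≤ (∑ i ∈ Finset.range n, x i) ^ n := by
  rcases n.eq_zero_or_pos with rfl | hn
  · simp
  have hn' : (0 : ℝ) < n := by exact_mod_cast hn
  have h := Real.geom_mean_le_arith_mean (Finset.range n) (fun _ => 1) x (by simp)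
    (by simpa using hn') (fun i _ => hx i)
  simp only [Real.rpow_one, one_mul, Finset.sum_const, Finset.card_range, nsmul_eq_mul,
    mul_one] at h
  have hP : 0 ≤ ∏ i ∈ Finset.range n, x i := Finset.prod_nonneg fun i _ => hx i
  have h2 := pow_le_pow_left₀ (Real.rpow_nonneg hP _) h n
  rw [Real.rpow_inv_natCast_pow hP hn.ne', div_pow, le_div_iff₀ (by positivity)] at h2
  linarith

lemma frobSq_one (p : ℕ) : frobSq (1 : Matrix (Fin p) (Fin p) ℝ) = p := by
  simp [frobSq, Matrix.one_apply]

lemma frobSq_zero (p q : ℕ) : frobSq (0 : Matrix (Fin p) (Fin q) ℝ) = 0 := by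
  simp [frobSq]

lemma frobSq_smul {p q : ℕ} (c : ℝ) (M : Matrix (Fin p) (Fin q) ℝ) :
    frobSq (c • M) = c ^ 2 * frobSq M := by
  simp [frobSq, mul_pow, Finset.mul_sum]

lemma frobSq_eq_trace {p q : ℕ} (M : Matrix (Fin p) (Fin q) ℝ) :
    frobSq M = (M.transpose * M).trace := by
  rw [frobSq, Finset.sum_comm]
  simp [Matrix.trace, Matrix.mul_apply, sq]

lemma eq_zero_of_frobSq_eq_zero {p q : ℕ} {M : Matrix (Fin p) (Fin q) ℝ} (h : frobSq M = 0) :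
    M = 0 := by
  ext a b
  have := sq_apply_le_frobSq M a b
  rw [h] at this
  exact pow_eq_zero_iff two_ne_zero |>.mp (le_antisymm this (sq_nonneg _))

lemma partialId_transpose (p q : ℕ) : (partialId p q).transpose = partialId q p := by
  ext a b
  simp [partialId, eq_comm]

lemma partialId_mul_partialId {r p : ℕ} (h : r ≤ p) : partialId r p * partialId p r = 1 := by
  ext a b
  rw [Matrix.mul_apply, Finset.sum_eq_single (Fin.castLE h a)]
  · simp [partialId, Matrix.one_apply, Fin.ext_iff]
  · intro x _ hx
    have : ¬ (a : ℕ) = x := fun h' => hx (Fin.ext h'.symm)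
    simp [partialId, this]
  · simp

lemma frobSq_partialId_mul {p r q : ℕ} (h : r ≤ p) (Y : Matrix (Fin r) (Fin q) ℝ) :
    frobSq (partialId p r * Y) = frobSq Y := by
  rw [frobSq_eq_trace, Matrix.transpose_mul, partialId_transpose, Matrix.mul_assoc,
    ← Matrix.mul_assoc (partialId r p), partialId_mul_partialId h, Matrix.one_mul,
    ← frobSq_eq_trace]

lemma frobSq_mul_partialId {p r q : ℕ} (h : r ≤ p) (X : Matrix (Fin q) (Fin r) ℝ) :
    frobSq (X * partialId r p) = frobSq X := by
  rw [← frobSq_transpose, Matrix.transpose_mul, partialId_transpose, frobSq_partialId_mul h,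
    frobSq_transpose]

lemma nuclearNorm_pow_le_flatness_pow {d : ℕ → ℕ} (V : Layers d) (m : ℕ) :
    ((m + 1 : ℕ) : ℝ) ^ (m + 1) * (d 0 * d (m + 1) *
      nuclearNorm (layerProd V 0 (m + 1)) ^ (2 * m)) ≤ flatness (m + 1) V ^ (m + 1) := by
  refine le_trans ?_ (card_pow_mul_prod_le_sum_pow (m + 1) _
    fun i => mul_nonneg (frobSq_nonneg _) (frobSq_nonneg _))
  refine mul_le_mul_of_nonneg_left ?_ (by positivity)
  -- The empty suffix and the empty prefix contribute d_L and d_0. Each remaining suffix is paired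
  -- with the prefix ending where it starts, so that their product is the full matrix.
  rw [Finset.prod_mul_distrib, Finset.prod_range_succ, Finset.prod_range_succ' (fun j =>
    frobSq (layerProd V 0 j)), layerProd_self, layerProd_self, frobSq_one, frobSq_one]
  have h : nuclearNorm (layerProd V 0 (m + 1)) ^ (2 * m) ≤
      (∏ j ∈ Finset.range m, frobSq (layerProd V (j + 1) (m + 1))) *
        ∏ j ∈ Finset.range m, frobSq (layerProd V 0 (j + 1)) := by
    rw [← Finset.prod_mul_distrib, pow_mul, ← Finset.card_range m, ← Finset.prod_const,
      Finset.card_range]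
    refine Finset.prod_le_prod (fun _ _ => sq_nonneg _) fun j hj => ?_
    have hj' := Finset.mem_range.mp hj
    rw [← layerProd_mul_layerProd V (j + 1).zero_le (show j + 1 ≤ m + 1 by omega)]
    exact nuclearNorm_mul_sq_le _ _
  have := mul_le_mul_of_nonneg_left h (show (0 : ℝ) ≤ d 0 * d (m + 1) by positivity)
  linarith

/-- Inner factors C_j B_j cancel and the scalar ratios telescope. -/
lemma layerProd_telescope {d : ℕ → ℕ} {r L : ℕ} (B : (j : ℕ) → Matrix (Fin (d j)) (Fin r) ℝ)
    (C : (j : ℕ) → Matrix (Fin r) (Fin (d j)) ℝ) (s : ℕ → ℝ) (hs : ∀ j, s j ≠ 0)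
    (hCB : ∀ j, 0 < j → j < L → C j * B j = 1) {j k : ℕ} (hjk : j < k) (hk : k ≤ L) :
    layerProd (fun i => (s (i + 1) / s i) • (B (i + 1) * C i)) j k =
      (s k / s j) • (B k * C j) := by
  induction k, hjk using Nat.le_induction with
  | base => rw [layerProd_succ _ le_rfl, layerProd_self, Matrix.mul_one]
  | succ k hjk ih =>
    rw [layerProd_succ _ (by omega), ih (by omega), Matrix.smul_mul, Matrix.mul_smul, smul_smul,
      Matrix.mul_assoc, ← Matrix.mul_assoc (C k), hCB k (by omega) (by omega), Matrix.one_mul]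
    congr 1
    have := hs k
    field_simp

/-- The balanced factors X and Y sit in the last and first layers, joined through r coordinates of
each hidden layer. Rescaling the hidden layers leaves the product fixed and makes all terms of the
flatness equal, as equality in AM-GM requires. -/
lemma exists_layers_flatness_pow_eq {d : ℕ → ℕ} {m : ℕ} (hm : 1 ≤ m) (h0 : 0 < d 0)
    (hL : 0 < d (m + 1)) (hd : ∀ i, 1 ≤ i → i ≤ m + 1 → min (d 0) (d (m + 1)) ≤ d i)
    (M : Matrix (Fin (d (m + 1))) (Fin (d 0)) ℝ) :
    ∃ V : Layers d, layerProd V 0 (m + 1) = M ∧ flatness (m + 1) V ^ (m + 1) =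
      ((m + 1 : ℕ) : ℝ) ^ (m + 1) * (d 0 * d (m + 1) * nuclearNorm M ^ (2 * m)) := by
  obtain ⟨r, hr, X, Y, hXY, hX, hY⟩ : ∃ r, r = min (d (m + 1)) (d 0) ∧
      ∃ (X : Matrix (Fin (d (m + 1))) (Fin r) ℝ) (Y : Matrix (Fin r) (Fin (d 0)) ℝ),
        X * Y = M ∧ frobSq X = nuclearNorm M ∧ frobSq Y = nuclearNorm M :=
    ⟨_, rfl, exists_balanced_factorization M⟩
  -- The scales below divide by N; for M = 0 the zero network has flatness 0, since there are at
  -- least two layers.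
  rcases (nuclearNorm_nonneg M).eq_or_lt with hN | hN
  · have hX0 : X = 0 := eq_zero_of_frobSq_eq_zero (hX.trans hN.symm)
    have hz : ∀ {j k : ℕ}, j < k → layerProd (0 : Layers d) j k = 0 := by
      intro j k hjk
      obtain ⟨k, rfl⟩ : ∃ k', k = k' + 1 := ⟨k - 1, by omega⟩
      rw [layerProd_succ _ (by omega), Pi.zero_apply, Matrix.zero_mul]
    have hf : flatness (m + 1) (0 : Layers d) = 0 := by
      refine Finset.sum_eq_zero fun j _ => ?_
      rcases j.eq_zero_or_pos with rfl | hj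
      · rw [hz (show 0 + 1 < m + 1 by omega), frobSq_zero, zero_mul]
      · rw [hz hj, frobSq_zero, mul_zero]
    refine ⟨0, ?_, ?_⟩
    · rw [hz (by omega), ← hXY, hX0, Matrix.zero_mul]
    · rw [hf, ← hN, zero_pow (by omega), zero_pow (by omega), mul_zero, mul_zero]
  set N := nuclearNorm M
  have h0' : (0 : ℝ) < d 0 := by exact_mod_cast h0
  have hL' : (0 : ℝ) < d (m + 1) := by exact_mod_cast hL
  have hrd : ∀ i, 1 ≤ i → i ≤ m + 1 → r ≤ d i := fun i h1 h2 => by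
    rw [hr, min_comm]; exact hd i h1 h2
  obtain ⟨T, hT, hTpow⟩ : ∃ T : ℝ, 0 < T ∧ T ^ (m + 1) = d 0 * d (m + 1) * N ^ (2 * m) := by
    have hpos : (0 : ℝ) < d 0 * d (m + 1) * N ^ (2 * m) := by positivity
    exact ⟨_, Real.rpow_pos_of_pos hpos _, Real.rpow_inv_natCast_pow hpos.le (by omega)⟩
  let B : (j : ℕ) → Matrix (Fin (d j)) (Fin r) ℝ :=
    Function.update (fun j => partialId (d j) r) (m + 1) X
  let C : (j : ℕ) → Matrix (Fin r) (Fin (d j)) ℝ :=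
    Function.update (fun j => partialId r (d j)) 0 Y
  have hBL : B (m + 1) = X := Function.update_self ..
  have hC0 : C 0 = Y := Function.update_self ..
  have hB : ∀ j, j ≠ m + 1 → B j = partialId (d j) r := fun j hj => Function.update_of_ne hj ..
  have hC : ∀ j, j ≠ 0 → C j = partialId r (d j) := fun j hj => Function.update_of_ne hj ..
  have hCB : ∀ j, 0 < j → j < m + 1 → C j * B j = 1 := fun j h1 h2 => by
    rw [hB j h2.ne, hC j h1.ne', partialId_mul_partialId (hrd j h1 h2.le)]
  -- Equating the terms to T forces d_0 N / ρ_1 = T and N² ρ_j / ρ_(j+1) = T, solved by this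
  -- formula. The last equation, d_L ρ_m N = T, is the choice of T.
  let ρ : ℕ → ℝ := fun j => if j = 0 ∨ m < j then 1 else d 0 * N ^ (2 * j) / (N * T ^ j)
  have hρ : ∀ j, 0 < ρ j := by
    intro j
    simp only [ρ]
    split_ifs <;> positivity
  have hρ' : ∀ j, 0 < j → j ≤ m → ρ j = d 0 * N ^ (2 * j) / (N * T ^ j) := fun j h1 h2 =>
    if_neg (by omega)
  have hρ0 : ρ 0 = 1 := by simp [ρ]
  have hρL : ρ (m + 1) = 1 := by simp [ρ]
  have htel := fun {j k : ℕ} => layerProd_telescope (L := m + 1) B C (fun j => √(ρ j))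
    (fun j => (Real.sqrt_pos.mpr (hρ j)).ne') hCB (j := j) (k := k)
  set V : Layers d := fun i => (√(ρ (i + 1)) / √(ρ i)) • (B (i + 1) * C i) with hV
  have hpre : ∀ j, 0 < j → j ≤ m → frobSq (layerProd V 0 j) = ρ j * N := by
    intro j h1 h2
    rw [htel h1 (by omega), frobSq_smul, hB j (by omega), hC0,
      frobSq_partialId_mul (hrd j h1 (by omega)), hY, div_pow, Real.sq_sqrt (hρ _).le,
      Real.sq_sqrt (hρ _).le, hρ0, div_one]
  have hsuf : ∀ j, j < m → frobSq (layerProd V (j + 1) (m + 1)) = N / ρ (j + 1) := by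
    intro j h2
    rw [htel (by omega) le_rfl, frobSq_smul, hC (j + 1) (by omega), hBL,
      frobSq_mul_partialId (hrd _ (by omega) (by omega)), hX, div_pow, Real.sq_sqrt (hρ _).le,
      Real.sq_sqrt (hρ _).le, hρL]
    ring
  refine ⟨V, ?_, ?_⟩
  · rw [htel (by omega) le_rfl, hρ0, hρL, hBL, hC0, hXY]
    simp
  have hterm : ∀ j ∈ Finset.range (m + 1),
      frobSq (layerProd V (j + 1) (m + 1)) * frobSq (layerProd V 0 j) = T := by
    intro j hj
    have hj' := Finset.mem_range.mp hj
    rcases (show j ≤ m by omega).eq_or_lt with rfl | hjm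
    · rw [layerProd_self, frobSq_one, hpre j hm le_rfl, hρ' j hm le_rfl]
      have : (d (j + 1) : ℝ) * (d 0 * N ^ (2 * j) / (N * T ^ j) * N) =
          d 0 * d (j + 1) * N ^ (2 * j) / T ^ j := by
        field_simp
      rw [this, ← hTpow, pow_succ]
      field_simp
    · rw [hsuf j hjm, hρ' (j + 1) (by omega) hjm]
      rcases j.eq_zero_or_pos with rfl | hj0
      · rw [layerProd_self, frobSq_one]
        field_simp
        ring
      · rw [hpre j hj0 hjm.le, hρ' j hj0 hjm.le]
        field_simp
        ring
  rw [flatness, Finset.sum_congr rfl hterm, Finset.sum_const, Finset.card_range, nsmul_eq_mul,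
    mul_pow, hTpow]

/-! ### The deterministic bound under the isometry property -/

lemma isClosed_interpolators {n p q : ℕ} (A : Fin n → Matrix (Fin p) (Fin q) ℝ)
    (Mstar : Matrix (Fin p) (Fin q) ℝ) : IsClosed {M | matrixLoss A Mstar M = 0} := by
  refine isClosed_eq ?_ continuous_const
  unfold matrixLoss frobInner
  fun_prop

lemma exists_isLeast_nuclearNorm_interpolators {n p q : ℕ} (A : Fin n → Matrix (Fin p) (Fin q) ℝ)
    (Mstar : Matrix (Fin p) (Fin q) ℝ) :
    ∃ m, IsLeast (nuclearNorm '' {M | matrixLoss A Mstar M = 0}) m :=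
  exists_isLeast_nuclearNorm_image (isClosed_interpolators A Mstar)
    ⟨Mstar, by simp [matrixLoss]⟩

lemma flatness_congr {d : ℕ → ℕ} {L : ℕ} {V V' : Layers d} (h : ∀ i < L, V i = V' i) :
    flatness L V = flatness L V' := by
  refine Finset.sum_congr rfl fun j hj => ?_
  have hj' := Finset.mem_range.mp hj
  rw [layerProd_congr (show j + 1 ≤ L by omega) fun i _ hi => h i hi,
    layerProd_congr j.zero_le fun i _ hi => h i (by omega)]

lemma nuclearNorm_le_three_mul_of_isMinTraceHessianInterpolator {n : ℕ} {d : ℕ → ℕ} {L : ℕ}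
    (hL : 2 ≤ L) (hd : ∀ i : ℕ, 1 ≤ i → i ≤ L → min (d 0) (d L) ≤ d i)
    {A : Fin n → Matrix (Fin (d L)) (Fin (d 0)) ℝ} (hA : RankOneRIP A)
    {Mstar M : Matrix (Fin (d L)) (Fin (d 0)) ℝ} (hM : matrixLoss A Mstar M = 0)
    {W : Params d L} (hW : IsMinTraceHessianInterpolator d L A Mstar W) :
    nuclearNorm (endToEnd d L W) ≤ 3 * nuclearNorm M := by
  obtain ⟨m, rfl⟩ : ∃ m, L = m + 1 := ⟨L - 1, by omega⟩
  have hm : 1 ≤ m := by omega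
  by_cases hpos : 0 < d 0 ∧ 0 < d (m + 1)
  swap
  · have hz : min (d (m + 1)) (d 0) = 0 := by omega
    simp [nuclearNorm, hz]
  obtain ⟨h0, h1⟩ := hpos
  obtain ⟨V, hV, hVf⟩ := exists_layers_flatness_pow_eq hm h0 h1 hd M
  have hloss : trainingLoss d (m + 1) A Mstar (fun i => V i) = 0 := by
    rw [trainingLoss, endToEnd_eq_layerProd, hV, hM]
  have hle : flatness (m + 1) (extendLayers W) ≤ 3 * flatness (m + 1) V := by
    calc _ ≤ _ := flatness_le_trace_hessian hA Mstar W
      _ ≤ _ := isMinOn_iff.mp hW.2 (fun i => V i) hloss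
      _ ≤ _ := trace_hessian_le_flatness hA Mstar _
      _ = _ := by
        congr 1
        exact flatness_congr fun i hi => by simp [extendLayers, hi]
  have hfl : 0 ≤ flatness (m + 1) (extendLayers W) :=
    Finset.sum_nonneg fun _ _ => mul_nonneg (frobSq_nonneg _) (frobSq_nonneg _)
  have h2 := pow_le_pow_left₀ hfl hle (m + 1)
  rw [mul_pow, hVf] at h2
  have h3 := (nuclearNorm_pow_le_flatness_pow (extendLayers W) m).trans h2
  rw [← endToEnd_eq_extendLayers] at h3
  set N := nuclearNorm M
  set K := nuclearNorm (endToEnd d (m + 1) W)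
  have hN : 0 ≤ N := nuclearNorm_nonneg M
  have hc : (0 : ℝ) < ((m + 1 : ℕ) : ℝ) ^ (m + 1) * (d 0 * d (m + 1)) := by
    have : (0 : ℝ) < d 0 := by exact_mod_cast h0
    have : (0 : ℝ) < d (m + 1) := by exact_mod_cast h1
    positivity
  have h4 : K ^ (2 * m) ≤ 3 ^ (m + 1) * N ^ (2 * m) := by
    refine le_of_mul_le_mul_left ?_ hc
    linarith
  -- Depth at least two means m + 1 ≤ 2m.
  have h5 : (3 : ℝ) ^ (m + 1) ≤ 3 ^ (2 * m) := pow_le_pow_right₀ (by norm_num) (by omega)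
  have h6 : K ^ (2 * m) ≤ (3 * N) ^ (2 * m) := by
    rw [mul_pow]
    exact h4.trans (mul_le_mul_of_nonneg_right h5 (by positivity))
  exact le_of_pow_le_pow_left₀ (by omega) (by positivity) h6

/-! ### Gaussian measurements and chi-square tails -/

lemma measurable_frobInner {p q : ℕ} (W : Matrix (Fin p) (Fin q) ℝ) :
    Measurable fun A : Matrix (Fin p) (Fin q) ℝ => frobInner A W := by
  change Measurable fun A : Fin p → Fin q → ℝ => ∑ a, ∑ b, A a b * W a b
  fun_prop

lemma frobInner_gaussianMatrix_charFun {p q : ℕ} (W : Matrix (Fin p) (Fin q) ℝ) (t : ℝ) :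
    charFun ((gaussianMatrix p q).map fun A => frobInner A W) t =
      charFun (gaussianReal 0 (frobSq W).toNNReal) t := by
  rw [charFun_apply_real, integral_map (measurable_frobInner W).aemeasurable
    (by fun_prop)]
  change ∫ A : Fin p → Fin q → ℝ, Complex.exp (t * ((∑ a, ∑ b, A a b * W a b : ℝ) : ℂ) *
    Complex.I) ∂(Measure.pi fun _ : Fin p => Measure.pi fun _ : Fin q => gaussianReal 0 1) = _
  have h : ∀ A : Fin p → Fin q → ℝ,
      Complex.exp (t * ((∑ a, ∑ b, A a b * W a b : ℝ) : ℂ) * Complex.I) =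
        ∏ a, ∏ b, Complex.exp ((t * W a b : ℝ) * (A a b : ℂ) * Complex.I) := by
    intro A
    simp_rw [← Complex.exp_sum]
    congr 1
    push_cast
    simp_rw [Finset.mul_sum, Finset.sum_mul]
    exact Finset.sum_congr rfl fun _ _ => Finset.sum_congr rfl fun _ _ => by ring
  simp_rw [h]
  rw [integral_fintype_prod_eq_prod (f := fun a (x : Fin q → ℝ) =>
    ∏ b, Complex.exp ((t * W a b : ℝ) * (x b : ℂ) * Complex.I))]
  simp_rw [fun a => integral_fintype_prod_eq_prod (μ := fun _ : Fin q => gaussianReal 0 1)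
    (f := fun b (x : ℝ) => Complex.exp ((t * W a b : ℝ) * (x : ℂ) * Complex.I)),
    ← charFun_apply_real, charFun_gaussianReal, ← Complex.exp_sum]
  congr 1
  rw [Real.coe_toNNReal _ (frobSq_nonneg W), frobSq]
  push_cast
  simp only [mul_zero, zero_mul, zero_sub, Finset.sum_neg_distrib, Finset.sum_mul,
    Finset.sum_div]
  congr 1
  exact Finset.sum_congr rfl fun _ _ => Finset.sum_congr rfl fun _ _ => by ring

instance isProbabilityMeasure_gaussianMatrix (p q : ℕ) :
    IsProbabilityMeasure (gaussianMatrix p q) :=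
  inferInstanceAs (IsProbabilityMeasure
    (Measure.pi fun _ : Fin p => Measure.pi fun _ : Fin q => gaussianReal 0 1))

lemma hasLaw_frobInner {p q : ℕ} {Ω : Type*} [MeasurableSpace Ω] {P : Measure Ω}
    {A : Ω → Matrix (Fin p) (Fin q) ℝ} (hA : HasLaw A (gaussianMatrix p q) P)
    (W : Matrix (Fin p) (Fin q) ℝ) :
    HasLaw (fun ω => frobInner (A ω) W) (gaussianReal 0 (frobSq W).toNNReal) P := by
  have h : HasLaw (fun A => frobInner A W) (gaussianReal 0 (frobSq W).toNNReal)
      (gaussianMatrix p q) := by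
    refine ⟨(measurable_frobInner W).aemeasurable, ?_⟩
    have : IsProbabilityMeasure ((gaussianMatrix p q).map fun A => frobInner A W) :=
      Measure.isProbabilityMeasure_map (measurable_frobInner W).aemeasurable
    exact Measure.ext_of_charFun (funext (frobInner_gaussianMatrix_charFun W))
  exact h.fun_comp hA

lemma integral_exp_mul_sq_gaussianReal {t : ℝ} (ht : t < 1 / 2) :
    ∫ x, Real.exp (t * x ^ 2) ∂(gaussianReal 0 1) = √((1 - 2 * t)⁻¹) := by
  rw [integral_gaussianReal_eq_integral_smul one_ne_zero]
  have h : ∀ x : ℝ, gaussianPDFReal 0 1 x • Real.exp (t * x ^ 2) =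
      (√(2 * Real.pi))⁻¹ * Real.exp (-(1 / 2 - t) * x ^ 2) := by
    intro x
    rw [gaussianPDFReal, smul_eq_mul, mul_assoc, ← Real.exp_add]
    simp only [NNReal.coe_one, mul_one, sub_zero]
    congr 2
    ring
  simp_rw [h]
  rw [integral_const_mul, integral_gaussian, ← Real.sqrt_inv, ← Real.sqrt_mul (by positivity)]
  congr 1
  have : 1 / 2 - t ≠ 0 := by linarith
  have : 1 - 2 * t ≠ 0 := by linarith
  have := Real.pi_ne_zero
  field_simp

section ChiSquare

variable {Ω : Type*} [MeasurableSpace Ω] {P : Measure Ω} {n : ℕ} {Z : Fin n → Ω → ℝ}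

lemma mgf_sum_sq_gaussian (hindep : iIndepFun Z P) (hlaw : ∀ i, HasLaw (Z i) (gaussianReal 0 1) P)
    {t : ℝ} (ht : t < 1 / 2) :
    mgf (∑ i, fun ω => Z i ω ^ 2) P t = √((1 - 2 * t)⁻¹) ^ n := by
  have hind : iIndepFun (fun i ω => Z i ω ^ 2) P :=
    hindep.comp (fun _ x => x ^ 2) fun _ => by fun_prop
  rw [hind.mgf_sum₀ fun i => (hlaw i).aemeasurable.pow_const 2]
  rw [Finset.prod_congr rfl fun i _ => ?_, Finset.prod_const, Finset.card_univ, Fintype.card_fin]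
  rw [mgf, ← integral_exp_mul_sq_gaussianReal ht, ← (hlaw i).map_eq,
    integral_map (hlaw i).aemeasurable (by fun_prop)]

lemma integrable_exp_mul_sum_sq_gaussian (hindep : iIndepFun Z P)
    (hlaw : ∀ i, HasLaw (Z i) (gaussianReal 0 1) P) {t : ℝ} (ht : t < 1 / 2) :
    Integrable (fun ω => Real.exp (t * (∑ i, fun ω => Z i ω ^ 2) ω)) P := by
  -- A non-integrable function has integral 0 by convention, so the positive value just computed
  -- proves integrability.
  refine Integrable.of_integral_ne_zero ?_
  have h := mgf_sum_sq_gaussian hindep hlaw ht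
  rw [mgf] at h
  rw [h]
  have : 0 < 1 - 2 * t := by linarith
  positivity

/-- Chernoff at t = 1/10, with exponent -0.121 + 0.12 per sample. The thresholds here and in the
lower tail are 1.1² and 0.9². -/
lemma chiSquare_upper_tail [IsProbabilityMeasure P] (hindep : iIndepFun Z P)
    (hlaw : ∀ i, HasLaw (Z i) (gaussianReal 0 1) P) :
    P.real {ω | 121 / 100 * (n : ℝ) ≤ ∑ i, Z i ω ^ 2} ≤ Real.exp (-(n : ℝ) / 1000) := by
  have h := measure_ge_le_exp_mul_mgf (μ := P) (X := ∑ i, fun ω => Z i ω ^ 2)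
    (121 / 100 * (n : ℝ)) (t := 1 / 10) (by norm_num)
    (integrable_exp_mul_sum_sq_gaussian hindep hlaw (by norm_num))
  rw [mgf_sum_sq_gaussian hindep hlaw (by norm_num)] at h
  simp only [Finset.sum_apply] at h
  refine h.trans ?_
  have hs : √((1 - 2 * (1 / 10 : ℝ))⁻¹) ≤ Real.exp (3 / 25) := by
    rw [Real.sqrt_le_left (Real.exp_pos _).le, ← Real.exp_nat_mul]
    refine le_trans ?_ (Real.quadratic_le_exp_of_nonneg (by norm_num))
    norm_num
  calc _ ≤ Real.exp (-(1 / 10) * (121 / 100 * n)) * Real.exp (3 / 25) ^ n := by gcongr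
    _ = Real.exp (-(n : ℝ) / 1000) := by
      rw [← Real.exp_nat_mul, ← Real.exp_add]
      congr 1
      ring

lemma chiSquare_lower_tail [IsProbabilityMeasure P] (hindep : iIndepFun Z P)
    (hlaw : ∀ i, HasLaw (Z i) (gaussianReal 0 1) P) :
    P.real {ω | ∑ i, Z i ω ^ 2 ≤ 81 / 100 * (n : ℝ)} ≤ Real.exp (-(n : ℝ) / 1000) := by
  have h := measure_le_le_exp_mul_mgf (μ := P) (X := ∑ i, fun ω => Z i ω ^ 2)
    (81 / 100 * (n : ℝ)) (t := -(1 / 10)) (by norm_num)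
    (integrable_exp_mul_sum_sq_gaussian hindep hlaw (by norm_num))
  rw [mgf_sum_sq_gaussian hindep hlaw (by norm_num)] at h
  simp only [Finset.sum_apply] at h
  refine h.trans ?_
  have hs : √((1 - 2 * -(1 / 10 : ℝ))⁻¹) ≤ Real.exp (-(82 / 1000)) := by
    rw [Real.sqrt_le_left (Real.exp_pos _).le, ← Real.exp_nat_mul]
    refine le_trans ?_ (Real.add_one_le_exp _)
    norm_num
  calc _ ≤ Real.exp (-(-(1 / 10)) * (81 / 100 * n)) * Real.exp (-(82 / 1000)) ^ n := by gcongr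
    _ = Real.exp (-(n : ℝ) / 1000) := by
      rw [← Real.exp_nat_mul, ← Real.exp_add]
      congr 1
      ring

end ChiSquare

lemma frobInner_zero {p q : ℕ} (A : Matrix (Fin p) (Fin q) ℝ) : frobInner A 0 = 0 := by
  simp [frobInner]

section Concentration

variable {Ω : Type*} [MeasurableSpace Ω] {P : Measure Ω} [IsProbabilityMeasure P] {n p q : ℕ}
  {A : Fin n → Ω → Matrix (Fin p) (Fin q) ℝ}

lemma measureReal_not_isometric_le_of_frobSq_eq_one (hn : 0 < n) (hindep : iIndepFun A P)
    (hlaw : ∀ i, HasLaw (A i) (gaussianMatrix p q) P) {W : Matrix (Fin p) (Fin q) ℝ}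
    (hW : frobSq W = 1) :
    P.real {ω | ¬ (81 / 100 ≤ (1 / (n : ℝ)) * ∑ i, frobInner (A i ω) W ^ 2 ∧
      (1 / (n : ℝ)) * ∑ i, frobInner (A i ω) W ^ 2 ≤ 121 / 100)} ≤
      2 * Real.exp (-(n : ℝ) / 1000) := by
  have hn' : (0 : ℝ) < n := by exact_mod_cast hn
  have hZi : iIndepFun (fun i ω => frobInner (A i ω) W) P :=
    hindep.comp (fun _ M => frobInner M W) fun _ => measurable_frobInner W
  have hZ : ∀ i, HasLaw (fun ω => frobInner (A i ω) W) (gaussianReal 0 1) P := fun i => by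
    simpa [hW] using hasLaw_frobInner (hlaw i) W
  calc _ ≤ P.real ({ω | ∑ i, frobInner (A i ω) W ^ 2 ≤ 81 / 100 * (n : ℝ)} ∪
        {ω | 121 / 100 * (n : ℝ) ≤ ∑ i, frobInner (A i ω) W ^ 2}) := by
        refine measureReal_mono fun ω hω => ?_
        rw [Set.mem_ofPred_eq, not_and_or, not_le, not_le, one_div_mul_eq_div,
          div_lt_iff₀ hn', lt_div_iff₀ hn'] at hω
        exact hω.imp le_of_lt le_of_lt
    _ ≤ _ := measureReal_union_le _ _
    _ ≤ _ := by linarith [chiSquare_lower_tail hZi hZ, chiSquare_upper_tail hZi hZ]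

lemma measureReal_not_isometric_le (hn : 0 < n) (hindep : iIndepFun A P)
    (hlaw : ∀ i, HasLaw (A i) (gaussianMatrix p q) P) (W : Matrix (Fin p) (Fin q) ℝ) :
    P.real {ω | ¬ (81 / 100 * frobSq W ≤ (1 / (n : ℝ)) * ∑ i, frobInner (A i ω) W ^ 2 ∧
      (1 / (n : ℝ)) * ∑ i, frobInner (A i ω) W ^ 2 ≤ 121 / 100 * frobSq W)} ≤
      2 * Real.exp (-(n : ℝ) / 1000) := by
  rcases (frobSq_nonneg W).eq_or_lt with h | h
  · rw [eq_zero_of_frobSq_eq_zero h.symm]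
    simp only [frobInner_zero, frobSq_zero, mul_zero, ne_eq, OfNat.ofNat_ne_zero,
      not_false_eq_true, zero_pow, Finset.sum_const_zero, le_refl, and_self, not_true_eq_false,
      Set.ofPred_false, measureReal_empty]
    positivity
  · have h1 : frobSq ((√(frobSq W))⁻¹ • W) = 1 := by
      rw [frobSq_smul, inv_pow, Real.sq_sqrt h.le, inv_mul_cancel₀ h.ne']
    refine le_trans (le_of_eq ?_) (measureReal_not_isometric_le_of_frobSq_eq_one hn hindep hlaw h1)
    congr 1
    ext ω
    simp only [Set.mem_ofPred_eq, frobInner_smul, mul_pow, inv_pow, Real.sq_sqrt h.le]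
    rw [← Finset.mul_sum, mul_left_comm, inv_mul_eq_div, le_div_iff₀ h, div_le_iff₀ h]

end Concentration

/-! ### Nets of the unit ball -/

section Nets

open Module

variable (E : Type*) [NormedAddCommGroup E] [NormedSpace ℝ E] [FiniteDimensional ℝ E]

/-- A 1-separated subset of the ball of radius 2 with the most elements is a net; the Besicovitch
bound limits its size. -/
lemma exists_finset_one_net :
    ∃ S : Finset E, S.card ≤ 5 ^ finrank ℝ E ∧ ∀ u : E, ‖u‖ ≤ 2 → ∃ s ∈ S, ‖u - s‖ ≤ 1 := by
  classical
  let Sep : Finset E → Prop := fun s => (∀ c ∈ s, ‖c‖ ≤ 2) ∧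
    ∀ c ∈ s, ∀ e ∈ s, c ≠ e → 1 ≤ ‖c - e‖
  let K : Set ℕ := {k | ∃ s, Sep s ∧ s.card = k}
  have hbd : ∀ s, Sep s → s.card ≤ 5 ^ finrank ℝ E := fun s hs =>
    Besicovitch.card_le_of_separated s hs.1 hs.2
  have hK : BddAbove K := ⟨5 ^ finrank ℝ E, by rintro _ ⟨s, hs, rfl⟩; exact hbd s hs⟩
  obtain ⟨S, hS, hcard⟩ : sSup K ∈ K :=
    Nat.sSup_mem ⟨0, ∅, ⟨by simp, by simp⟩, rfl⟩ hK
  refine ⟨S, hbd S hS, fun u hu => ?_⟩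
  by_contra! hfar
  have huS : u ∉ S := fun h => by
    have := hfar u h
    rw [sub_self, norm_zero] at this
    exact absurd this (by norm_num)
  have hins : Sep (insert u S) := by
    refine ⟨fun c hc => ?_, fun c hc e he hce => ?_⟩
    · rcases Finset.mem_insert.mp hc with rfl | hc
      exacts [hu, hS.1 c hc]
    · rcases Finset.mem_insert.mp hc with rfl | hc' <;> rcases Finset.mem_insert.mp he with rfl | he'
      · exact absurd rfl hce
      · exact (hfar e he').le
      · rw [norm_sub_rev]
        exact (hfar c hc').le
      · exact hS.2 c hc' e he' hce
  have := le_csSup hK ⟨insert u S, hins, rfl⟩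
  rw [Finset.card_insert_of_notMem huS] at this
  omega

/-- Dyadic nets of the unit ball, obtained by adding up nets at successive scales. -/
lemma exists_finset_dyadic_net (k : ℕ) :
    ∃ S : Finset E, S.card ≤ (5 ^ finrank ℝ E) ^ k ∧
      ∀ u : E, ‖u‖ ≤ 1 → ∃ s ∈ S, ‖u - s‖ ≤ (1 / 2) ^ k := by
  classical
  induction k with
  | zero => exact ⟨{0}, by simp, fun u hu => ⟨0, by simp, by simpa using hu⟩⟩
  | succ k ih =>
    obtain ⟨S, hS, hSnet⟩ := ih
    obtain ⟨T, hT, hTnet⟩ := exists_finset_one_net E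
    refine ⟨Finset.image₂ (fun s t => s + ((1 : ℝ) / 2) ^ (k + 1) • t) S T, ?_, fun u hu => ?_⟩
    · rw [pow_succ]
      exact (Finset.card_image₂_le _ _ _).trans (Nat.mul_le_mul hS hT)
    · obtain ⟨s, hs, hus⟩ := hSnet u hu
      obtain ⟨t, ht, hut⟩ := hTnet ((2 : ℝ) ^ (k + 1) • (u - s)) (by
        rw [norm_smul, Real.norm_of_nonneg (by positivity)]
        calc (2 : ℝ) ^ (k + 1) * ‖u - s‖ ≤ 2 ^ (k + 1) * (1 / 2) ^ k := by gcongr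
          _ = 2 * (2 * (1 / 2)) ^ k := by rw [mul_pow]; ring
          _ = 2 := by norm_num)
      refine ⟨_, Finset.mem_image₂_of_mem hs ht, ?_⟩
      have h : u - (s + ((1 : ℝ) / 2) ^ (k + 1) • t) =
          ((1 : ℝ) / 2) ^ (k + 1) • ((2 : ℝ) ^ (k + 1) • (u - s) - t) := by
        rw [smul_sub, smul_smul, ← mul_pow]
        norm_num
        abel
      rw [h, norm_smul, Real.norm_of_nonneg (by positivity)]
      exact mul_le_of_le_one_right (by positivity) hut

end Nets

/-! ### From a net to all pairs of vectors -/

section Bilinear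

variable {E F G : Type*} [NormedAddCommGroup E] [NormedSpace ℝ E] [NormedAddCommGroup F]
  [NormedSpace ℝ F] [NormedAddCommGroup G] [NormedSpace ℝ G]

lemma norm_inv_norm_smul {E : Type*} [NormedAddCommGroup E] [NormedSpace ℝ E] {u : E}
    (hu : u ≠ 0) : ‖‖u‖⁻¹ • u‖ = 1 := by
  rw [norm_smul, norm_inv, norm_norm, inv_mul_cancel₀ (norm_ne_zero_iff.mpr hu)]

lemma norm_bilinear_sub_le (Φ : E →L[ℝ] F →L[ℝ] G) {ε : ℝ} {u u₀ : E} {v v₀ : F}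
    (hu₀ : ‖u₀‖ ≤ 1 + ε) (hv : ‖v‖ = 1) (huu₀ : ‖u - u₀‖ ≤ ε) (hvv₀ : ‖v - v₀‖ ≤ ε) :
    ‖Φ u v - Φ u₀ v₀‖ ≤ (ε + (1 + ε) * ε) * ‖Φ‖ := by
  have hε : 0 ≤ ε := (norm_nonneg _).trans huu₀
  have h : Φ u v - Φ u₀ v₀ = Φ (u - u₀) v + Φ u₀ (v - v₀) := by
    simp
  calc ‖Φ u v - Φ u₀ v₀‖ ≤ ‖Φ (u - u₀) v‖ + ‖Φ u₀ (v - v₀)‖ := by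
        rw [h]; exact norm_add_le _ _
    _ ≤ ‖Φ‖ * ‖u - u₀‖ * ‖v‖ + ‖Φ‖ * ‖u₀‖ * ‖v - v₀‖ :=
        add_le_add (Φ.le_opNorm₂ _ _) (Φ.le_opNorm₂ _ _)
    _ ≤ ‖Φ‖ * ε * 1 + ‖Φ‖ * (1 + ε) * ε := by
        rw [hv]
        gcongr
    _ = _ := by ring

lemma norm_bilinear_eq_of_ne_zero (Φ : E →L[ℝ] F →L[ℝ] G) {u : E} {v : F} (hu : u ≠ 0)
    (hv : v ≠ 0) : ‖Φ u v‖ = ‖Φ (‖u‖⁻¹ • u) (‖v‖⁻¹ • v)‖ * ‖u‖ * ‖v‖ := by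
  have hu' := norm_ne_zero_iff.mpr hu
  have hv' := norm_ne_zero_iff.mpr hv
  simp only [map_smul, smul_apply, norm_smul, norm_inv, norm_norm]
  field_simp

/-- Moving to the net costs a small multiple of ‖Φ‖. The upper estimate thus bounds ‖Φ‖ by a
constant plus that multiple of itself; solving for ‖Φ‖ makes both estimates absolute. -/
lemma norm_bilinear_bounds_of_net (Φ : E →L[ℝ] F →L[ℝ] G) {S : Set E} {T : Set F}
    (hS : ∀ u : E, ‖u‖ ≤ 1 → ∃ s ∈ S, ‖u - s‖ ≤ 1 / 64)
    (hT : ∀ v : F, ‖v‖ ≤ 1 → ∃ t ∈ T, ‖v - t‖ ≤ 1 / 64)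
    (h : ∀ u ∈ S, ∀ v ∈ T, 9 / 10 * (‖u‖ * ‖v‖) ≤ ‖Φ u v‖ ∧ ‖Φ u v‖ ≤ 11 / 10 * (‖u‖ * ‖v‖))
    (u : E) (v : F) :
    8 / 10 * (‖u‖ * ‖v‖) ≤ ‖Φ u v‖ ∧ ‖Φ u v‖ ≤ 12 / 10 * (‖u‖ * ‖v‖) := by
  have key : ∀ (u : E) (v : F), ‖u‖ = 1 → ‖v‖ = 1 →
      -- 129/4096 is ε + (1 + ε)ε at ε = 1/64.
      9 / 10 * (63 / 64 * (63 / 64)) - 129 / 4096 * ‖Φ‖ ≤ ‖Φ u v‖ ∧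
        ‖Φ u v‖ ≤ 11 / 10 * (65 / 64 * (65 / 64)) + 129 / 4096 * ‖Φ‖ := by
    intro u v hu hv
    obtain ⟨u₀, hu₀, huu₀⟩ := hS u hu.le
    obtain ⟨v₀, hv₀, hvv₀⟩ := hT v hv.le
    obtain ⟨h1, h2⟩ := h u₀ hu₀ v₀ hv₀
    have hua := norm_sub_norm_le u u₀
    have hub := norm_sub_norm_le u₀ u
    have hva := norm_sub_norm_le v v₀
    have hvb := norm_sub_norm_le v₀ v
    rw [norm_sub_rev] at hub hvb
    have hu1 : ‖u₀‖ ≤ 65 / 64 := by linarith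
    have hv1 : ‖v₀‖ ≤ 65 / 64 := by linarith
    have hu2 : 63 / 64 ≤ ‖u₀‖ := by linarith
    have hv2 : 63 / 64 ≤ ‖v₀‖ := by linarith
    have hd := norm_bilinear_sub_le Φ (ε := 1 / 64) (by linarith) hv huu₀ hvv₀
    have hup : ‖u₀‖ * ‖v₀‖ ≤ 65 / 64 * (65 / 64) := by gcongr
    have hlo : (63 / 64 * (63 / 64) : ℝ) ≤ ‖u₀‖ * ‖v₀‖ := by gcongr
    have hda := norm_sub_norm_le (Φ u v) (Φ u₀ v₀)
    have hdb := norm_sub_norm_le (Φ u₀ v₀) (Φ u v)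
    rw [norm_sub_rev] at hdb
    constructor <;> linarith
  have hΦ : ‖Φ‖ ≤ 12 / 10 := by
    have : ‖Φ‖ ≤ 11 / 10 * (65 / 64 * (65 / 64)) + 129 / 4096 * ‖Φ‖ := by
      refine Φ.opNorm_le_bound₂ (by positivity) fun u v => ?_
      by_cases hu : u = 0
      · simp [hu]
      by_cases hv : v = 0
      · simp [hv]
      rw [norm_bilinear_eq_of_ne_zero Φ hu hv]
      gcongr
      exact (key _ _ (norm_inv_norm_smul hu) (norm_inv_norm_smul hv)).2
    linarith
  refine ⟨?_, ?_⟩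
  · by_cases hu : u = 0
    · simp [hu]
    by_cases hv : v = 0
    · simp [hv]
    rw [norm_bilinear_eq_of_ne_zero Φ hu hv, mul_assoc]
    gcongr
    have := (key _ _ (norm_inv_norm_smul hu) (norm_inv_norm_smul hv)).1
    linarith
  · rw [← mul_assoc]
    exact (Φ.le_opNorm₂ u v).trans (by gcongr)

end Bilinear

/-! ### The rank-one isometry property of Gaussian measurements -/

section MeasurementMap

variable {n p q : ℕ} (A : Fin n → Matrix (Fin p) (Fin q) ℝ)

/-- The normalized measurements of `u vᵀ`, as a bilinear map. -/
noncomputable def measurementMap : EuclideanSpace ℝ (Fin p) →L[ℝ] EuclideanSpace ℝ (Fin q) →L[ℝ]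
    EuclideanSpace ℝ (Fin n) :=
  LinearMap.toContinuousLinearMap (LinearMap.toContinuousLinearMap.toLinearMap ∘ₗ
    LinearMap.mk₂ ℝ (fun (u : EuclideanSpace ℝ (Fin p)) (v : EuclideanSpace ℝ (Fin q)) =>
      WithLp.toLp 2 fun i => (√(n : ℝ))⁻¹ * frobInner (A i) (Matrix.vecMulVec u v))
      (fun u u' v => by
        ext i
        simp [Matrix.add_vecMulVec, frobInner_add, mul_add])
      (fun c u v => by
        ext i
        simp [Matrix.smul_vecMulVec, frobInner_smul, mul_left_comm])
      (fun u v v' => by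
        ext i
        simp [Matrix.vecMulVec_add, frobInner_add, mul_add])
      (fun c u v => by
        ext i
        simp [Matrix.vecMulVec_smul, frobInner_smul, mul_left_comm]))

lemma norm_sq_measurementMap (u : EuclideanSpace ℝ (Fin p)) (v : EuclideanSpace ℝ (Fin q)) :
    ‖measurementMap A u v‖ ^ 2 =
      (1 / (n : ℝ)) * ∑ i, frobInner (A i) (Matrix.vecMulVec u v) ^ 2 := by
  rw [EuclideanSpace.norm_sq_eq, Finset.mul_sum]
  refine Finset.sum_congr rfl fun i _ => ?_
  simp [measurementMap, mul_pow]

lemma frobSq_vecMulVec (u : Fin p → ℝ) (v : Fin q → ℝ) :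
    frobSq (Matrix.vecMulVec u v) = (∑ a, u a ^ 2) * ∑ b, v b ^ 2 := by
  simp [frobSq, Matrix.vecMulVec_apply, mul_pow, Finset.sum_mul_sum]

lemma frobSq_vecMulVec_eq_norm (u : EuclideanSpace ℝ (Fin p)) (v : EuclideanSpace ℝ (Fin q)) :
    frobSq (Matrix.vecMulVec u v) = (‖u‖ * ‖v‖) ^ 2 := by
  rw [frobSq_vecMulVec, mul_pow, EuclideanSpace.norm_sq_eq, EuclideanSpace.norm_sq_eq]
  simp

lemma rankOneRIP_of_net {S : Set (EuclideanSpace ℝ (Fin p))} {T : Set (EuclideanSpace ℝ (Fin q))}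
    (hS : ∀ u, ‖u‖ ≤ 1 → ∃ s ∈ S, ‖u - s‖ ≤ 1 / 64)
    (hT : ∀ v, ‖v‖ ≤ 1 → ∃ t ∈ T, ‖v - t‖ ≤ 1 / 64)
    (h : ∀ u ∈ S, ∀ v ∈ T, 81 / 100 * frobSq (Matrix.vecMulVec u v) ≤
        (1 / (n : ℝ)) * ∑ i, frobInner (A i) (Matrix.vecMulVec u v) ^ 2 ∧
      (1 / (n : ℝ)) * ∑ i, frobInner (A i) (Matrix.vecMulVec u v) ^ 2 ≤
        121 / 100 * frobSq (Matrix.vecMulVec u v)) : RankOneRIP A := by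
  intro u v
  obtain ⟨h1, h2⟩ := norm_bilinear_bounds_of_net (measurementMap A) hS hT (fun u hu v hv => by
    obtain ⟨h1, h2⟩ := h u hu v hv
    rw [← norm_sq_measurementMap, frobSq_vecMulVec_eq_norm] at h1 h2
    constructor
    · refine le_of_sq_le_sq ?_ (norm_nonneg _)
      linarith
    · refine le_of_sq_le_sq ?_ (by positivity)
      linarith) (WithLp.toLp 2 u) (WithLp.toLp 2 v)
  have h3 := norm_sq_measurementMap A (WithLp.toLp 2 u) (WithLp.toLp 2 v)
  have h4 := frobSq_vecMulVec_eq_norm (WithLp.toLp 2 u) (WithLp.toLp 2 v)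
  simp only at h3 h4
  rw [← frobSq_vecMulVec, h4, ← h3]
  have h5 := pow_le_pow_left₀ (by positivity) h1 2
  have h6 := pow_le_pow_left₀ (norm_nonneg _) h2 2
  rw [mul_pow] at h5 h6
  have h7 := sq_nonneg (‖WithLp.toLp 2 u‖ * ‖WithLp.toLp 2 v‖)
  -- 0.8² ≥ 1/2 and 1.2² ≤ 3/2.
  constructor <;> linarith

end MeasurementMap

/-- With 5 ≤ e² and 2 ≤ e the union bound costs 12(p + q) + 1 in the exponent, at most 15(p + q) ≤
n/2000 because p ≥ 1. -/
lemma card_net_mul_exp_le {n p q : ℕ} (hp : 0 < p) (h : 30000 * ((q : ℝ) + p) ≤ n) :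
    (((5 ^ p) ^ 6 * (5 ^ q) ^ 6 : ℕ) : ℝ) * (2 * Real.exp (-(n : ℝ) / 1000)) ≤
      Real.exp (-(1 / 2000) * n) := by
  have hp' : (1 : ℝ) ≤ p := by exact_mod_cast hp
  have h5 : (5 : ℝ) ≤ Real.exp 2 := by
    refine le_trans ?_ (Real.quadratic_le_exp_of_nonneg (by norm_num))
    norm_num
  have h2 : (2 : ℝ) ≤ Real.exp 1 := by
    linarith [Real.add_one_le_exp (1 : ℝ)]
  push_cast
  calc ((5 : ℝ) ^ p) ^ 6 * (5 ^ q) ^ 6 * (2 * Real.exp (-(n : ℝ) / 1000))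
      ≤ (Real.exp 2 ^ p) ^ 6 * (Real.exp 2 ^ q) ^ 6 * (Real.exp 1 * Real.exp (-(n : ℝ) / 1000)) := by
        gcongr
    _ = Real.exp (12 * p + 12 * q + 1 - n / 1000) := by
        simp_rw [← Real.exp_nat_mul, ← Real.exp_add]
        congr 1
        push_cast
        ring
    _ ≤ _ := by
        refine Real.exp_le_exp.mpr ?_
        linarith

lemma rankOneRIP_of_height_eq_zero {n q : ℕ} (A : Fin n → Matrix (Fin 0) (Fin q) ℝ) :
    RankOneRIP A := by
  intro u v
  simp [frobInner]

/-- Gaussian measurements have the rank-one restricted isometry property with overwhelming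
probability. -/
lemma exists_measurableSet_rankOneRIP {Ω : Type*} [MeasurableSpace Ω] {P : Measure Ω}
    [IsProbabilityMeasure P] {n p q : ℕ} (hn : 30000 * ((q : ℝ) + p) ≤ n)
    {A : Fin n → Ω → Matrix (Fin p) (Fin q) ℝ} (hindep : iIndepFun A P)
    (hlaw : ∀ i, HasLaw (A i) (gaussianMatrix p q) P) :
    ∃ G : Set Ω, MeasurableSet G ∧ 1 - Real.exp (-(1 / 2000) * (n : ℝ)) ≤ P.real G ∧
      ∀ ω ∈ G, RankOneRIP fun i => A i ω := by
  -- For n = 0 the required probability is 0, so the empty event serves.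
  rcases n.eq_zero_or_pos with rfl | hn0
  · exact ⟨∅, MeasurableSet.empty, by simp, by simp⟩
  rcases p.eq_zero_or_pos with rfl | hp
  · refine ⟨Set.univ, MeasurableSet.univ, ?_, fun ω _ => rankOneRIP_of_height_eq_zero _⟩
    rw [probReal_univ]
    linarith [Real.exp_pos (-(1 / 2000) * (n : ℝ))]
  -- Six halvings give the mesh 1/64.
  obtain ⟨S, hS, hSnet⟩ := exists_finset_dyadic_net (EuclideanSpace ℝ (Fin p)) 6
  obtain ⟨T, hT, hTnet⟩ := exists_finset_dyadic_net (EuclideanSpace ℝ (Fin q)) 6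
  rw [finrank_euclideanSpace_fin] at hS hT
  let bad : EuclideanSpace ℝ (Fin p) × EuclideanSpace ℝ (Fin q) → Set Ω := fun z =>
    {ω | ¬ (81 / 100 * frobSq (Matrix.vecMulVec z.1 z.2) ≤
        (1 / (n : ℝ)) * ∑ i, frobInner (A i ω) (Matrix.vecMulVec z.1 z.2) ^ 2 ∧
      (1 / (n : ℝ)) * ∑ i, frobInner (A i ω) (Matrix.vecMulVec z.1 z.2) ^ 2 ≤
        121 / 100 * frobSq (Matrix.vecMulVec z.1 z.2))}
  set B : Set Ω := ⋃ z ∈ S ×ˢ T, bad z with hB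
  have hPB : P.real B ≤ Real.exp (-(1 / 2000) * (n : ℝ)) := by
    calc P.real B ≤ ∑ z ∈ S ×ˢ T, P.real (bad z) := measureReal_biUnion_finset_le _ _
      _ ≤ ∑ z ∈ S ×ˢ T, 2 * Real.exp (-(n : ℝ) / 1000) :=
          Finset.sum_le_sum fun z _ => measureReal_not_isometric_le hn0 hindep hlaw _
      _ = ((S.card * T.card : ℕ) : ℝ) * (2 * Real.exp (-(n : ℝ) / 1000)) := by
          rw [Finset.sum_const, Finset.card_product, nsmul_eq_mul]
      _ ≤ (((5 ^ p) ^ 6 * (5 ^ q) ^ 6 : ℕ) : ℝ) * (2 * Real.exp (-(n : ℝ) / 1000)) := by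
          refine mul_le_mul_of_nonneg_right ?_ (by positivity)
          exact_mod_cast Nat.mul_le_mul hS hT
      _ ≤ _ := card_net_mul_exp_le hp hn
  -- The measurements are only a.e. measurable, so B is replaced by a measurable superset of equal
  -- measure.
  refine ⟨(toMeasurable P B)ᶜ, (measurableSet_toMeasurable P B).compl, ?_, fun ω hω => ?_⟩
  · rw [probReal_compl_eq_one_sub (measurableSet_toMeasurable P B), measureReal_def,
      measure_toMeasurable, ← measureReal_def]
    linarith
  · have hωB : ω ∉ B := fun h => hω (subset_toMeasurable P B h)
    refine rankOneRIP_of_net _ (S := S) (T := T)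
      (fun u hu => ?_) (fun v hv => ?_) fun u hu v hv => ?_
    · obtain ⟨s, hs, hus⟩ := hSnet u hu
      exact ⟨s, hs, hus.trans (by norm_num)⟩
    · obtain ⟨s, hs, hus⟩ := hTnet v hv
      exact ⟨s, hs, hus.trans (by norm_num)⟩
    · by_contra hbad
      exact hωB (Set.mem_biUnion (Finset.mk_mem_product hu hv) hbad)

end DeepMatrixFactorization

theorem corollary1 :
    ∃ C c : ℝ, 0 < C ∧ 0 < c ∧
      ∀ (L : ℕ) (_hL : 2 ≤ L) (d : ℕ → ℕ)
        (_hd : ∀ i : ℕ, 1 ≤ i → i ≤ L → min (d 0) (d L) ≤ d i)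
        (n : ℕ) (_hn : C * ((d 0 : ℝ) + (d L : ℝ)) ≤ (n : ℝ))
        (Mstar : Matrix (Fin (d L)) (Fin (d 0)) ℝ)
        (Ω : Type*) [MeasurableSpace Ω] (P : Measure Ω) [IsProbabilityMeasure P]
        (A : Fin n → Ω → Matrix (Fin (d L)) (Fin (d 0)) ℝ)
        (_hindep : iIndepFun A P)
        (_hlaw : ∀ i, HasLaw (A i) (gaussianMatrix (d L) (d 0)) P),
        ∃ G : Set Ω, MeasurableSet G ∧ 1 - Real.exp (-c * (n : ℝ)) ≤ P.real G ∧
          ∀ ω ∈ G, ∃ m : ℝ,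
            IsLeast (nuclearNorm '' {M | matrixLoss (fun i => A i ω) Mstar M = 0}) m ∧
            ∀ W : Params d L,
              IsMinTraceHessianInterpolator d L (fun i => A i ω) Mstar W →
              nuclearNorm (endToEnd d L W) ≤ 3 * m ∧ m ≤ nuclearNorm (endToEnd d L W) := by
  refine ⟨30000, 1 / 2000, by norm_num, by norm_num, ?_⟩
  intro L hL d hd n hn Mstar Ω _ P _ A hindep hlaw
  obtain ⟨G, hG, hPG, hRIP⟩ := exists_measurableSet_rankOneRIP hn hindep hlaw
  refine ⟨G, hG, hPG, fun ω hω => ?_⟩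
  obtain ⟨m, hm⟩ := exists_isLeast_nuclearNorm_interpolators (fun i => A i ω) Mstar
  obtain ⟨M, hM, hMm⟩ := hm.1
  refine ⟨m, hm, fun W hW => ⟨?_, hm.2 ⟨_, hW.1, rfl⟩⟩⟩
  rw [← hMm]
  exact nuclearNorm_le_three_mul_of_isMinTraceHessianInterpolator hL hd (hRIP ω hω) hM hW
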